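/- Let $G$ be a finite group, $\mathrm{Sym}(G)$ the group of all permutations of the set $G$, and $G_r\le \mathrm{Sym}(G)$ the subgroup of all right translations $x\mapsto xg$, $g\in G$. Let $\mathrm{Hol}(G)=N_{\mathrm{Sym}(G)}(G_r)$ be the holomorph of $G$. Two subgroups of $\mathrm{Sym}(G)$ are called $2$-equivalent if they have the same orbits in the componentwise action on $G\times G$; the $2$-closure of $K\le\mathrm{Sym}(G)$ is the largest subgroup of $\mathrm{Sym}(G)$ that is $2$-equivalent to $K$, and $K$ is called $2$-closed if it is equal to its $2$-closure. The group $G$ is called an $\mathrm{NCI}^{(2)}$-group if for every $2$-closed group $K$ with $G_r\le K\le \mathrm{Hol}(G)$, every regular subgroup of $K$ isomorphic to $G$ is conjugate in $K$ to $G_r$. Then a finite cyclic group $G$ is an $\mathrm{NCI}^{(2)}$-group if and only if $|G|$ is not divisible by $8$. -/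

import Mathlib

namespace PermGroup

/-- Two permutation groups on `Ω` are 2-equivalent if they have the same orbits in their
componentwise actions on `Ω × Ω`. -/
def TwoEquivalent {Ω : Type*} (K₁ K₂ : Subgroup (Equiv.Perm Ω)) : Prop :=
  MulAction.orbitRel K₁ (Ω × Ω) = MulAction.orbitRel K₂ (Ω × Ω)

/-- The 2-closure of a permutation group `K`: the largest permutation group that is
2-equivalent to `K` (see `isGreatest_twoClosure`). -/
def twoClosure {Ω : Type*} (K : Subgroup (Equiv.Perm Ω)) : Subgroup (Equiv.Perm Ω) :=
  sSup {L | TwoEquivalent L K}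

/-- A permutation group is 2-closed if it is equal to its 2-closure. -/
def IsTwoClosed {Ω : Type*} (K : Subgroup (Equiv.Perm Ω)) : Prop :=
  twoClosure K = K

/-- A permutation group is regular if it is transitive and all its point stabilizers are
trivial. -/
def IsRegularPerm {Ω : Type*} (R : Subgroup (Equiv.Perm Ω)) : Prop :=
  MulAction.IsPretransitive R Ω ∧ ∀ x : Ω, MulAction.stabilizer R x = ⊥

theorem mem_twoClosure {Ω : Type*} {K : Subgroup (Equiv.Perm Ω)} {f : Equiv.Perm Ω} :
    f ∈ twoClosure K ↔ ∀ x y : Ω, ∃ k ∈ K, k x = f x ∧ k y = f y := by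
  let C : Subgroup (Equiv.Perm Ω) :=
    { carrier := {f | ∀ x y : Ω, ∃ k ∈ K, k x = f x ∧ k y = f y}
      one_mem' := fun x y => ⟨1, K.one_mem, rfl, rfl⟩
      mul_mem' := by
        intro a b ha hb x y
        obtain ⟨k, hk, h1, h2⟩ := hb x y
        obtain ⟨l, hl, h3, h4⟩ := ha (b x) (b y)
        exact ⟨l * k, K.mul_mem hl hk, by simp [h1, h3], by simp [h2, h4]⟩
      inv_mem' := by
        intro a ha x y
        obtain ⟨k, hk, h1, h2⟩ := ha (a⁻¹ x) (a⁻¹ y)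
        refine ⟨k⁻¹, K.inv_mem hk, ?_, ?_⟩
        · rw [Equiv.Perm.inv_eq_iff_eq, h1]; simp
        · rw [Equiv.Perm.inv_eq_iff_eq, h2]; simp }
  have hKC : K ≤ C := fun k hk x y => ⟨k, hk, rfl, rfl⟩
  have hC : TwoEquivalent C K := by
    refine Setoid.ext fun p q => ?_
    rw [MulAction.orbitRel_apply, MulAction.orbitRel_apply]
    constructor
    · rintro ⟨⟨c, hc⟩, hcq⟩
      obtain ⟨k, hk, h1, h2⟩ := hc q.1 q.2
      exact ⟨⟨k, hk⟩, by rw [← hcq]; exact Prod.ext h1 h2⟩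
    · rintro ⟨⟨k, hk⟩, hkq⟩
      exact ⟨⟨k, hKC hk⟩, hkq⟩
  have hle : ∀ L, TwoEquivalent L K → L ≤ C := by
    intro L hL l hl x y
    have h : MulAction.orbitRel L (Ω × Ω) (l x, l y) (x, y) := ⟨⟨l, hl⟩, rfl⟩
    rw [hL] at h
    obtain ⟨⟨k, hk⟩, hkx⟩ := h
    exact ⟨k, hk, congrArg Prod.fst hkx, congrArg Prod.snd hkx⟩
  have h : twoClosure K = C := le_antisymm (sSup_le hle) (le_sSup hC)
  rw [h]
  exact Iff.rfl

theorem isGreatest_twoClosure {Ω : Type*} (K : Subgroup (Equiv.Perm Ω)) :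
    IsGreatest {L | TwoEquivalent L K} (twoClosure K) := by
  refine ⟨?_, fun L hL => le_sSup hL⟩
  refine Setoid.ext fun p q => ?_
  rw [MulAction.orbitRel_apply, MulAction.orbitRel_apply]
  constructor
  · rintro ⟨⟨c, hc⟩, hcq⟩
    obtain ⟨k, hk, h1, h2⟩ := mem_twoClosure.1 hc q.1 q.2
    exact ⟨⟨k, hk⟩, by rw [← hcq]; exact Prod.ext h1 h2⟩
  · rintro ⟨⟨k, hk⟩, hkq⟩
    exact ⟨⟨k, mem_twoClosure.2 fun x y => ⟨k, hk, rfl, rfl⟩⟩, hkq⟩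

/-- The group `G_r` of all right translations `x ↦ x * g` of `G`. -/
def rightTranslations (G : Type*) [Group G] : Subgroup (Equiv.Perm G) :=
  (MulAction.toPermHom (MulOpposite G) G).range

theorem mem_rightTranslations {G : Type*} [Group G] {f : Equiv.Perm G} :
    f ∈ rightTranslations G ↔ ∃ g : G, Equiv.mulRight g = f := by
  constructor
  · rintro ⟨g, rfl⟩
    exact ⟨g.unop, Equiv.ext fun x => rfl⟩
  · rintro ⟨g, rfl⟩
    exact ⟨MulOpposite.op g, Equiv.ext fun x => rfl⟩

/-- The holomorph of `G`: the normalizer of `G_r` in the symmetric group on `G`. -/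
def holomorph (G : Type*) [Group G] : Subgroup (Equiv.Perm G) :=
  Subgroup.normalizer (rightTranslations G : Set (Equiv.Perm G))

/-- A permutation group on the set `G` is `G`-regular if it is regular and isomorphic to the
group `G`. -/
def IsGRegular {G : Type*} [Group G] (R : Subgroup (Equiv.Perm G)) : Prop :=
  IsRegularPerm R ∧ Nonempty (R ≃* G)

/-- A permutation group `K` on `G` (containing `G_r`) is `G`-transjugate if every `G`-regular
subgroup `R` of `K` is conjugate in `K` to `G_r`. -/
def IsGTransjugate {G : Type*} [Group G] (K : Subgroup (Equiv.Perm G)) : Prop :=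
  ∀ R : Subgroup (Equiv.Perm G), R ≤ K → IsGRegular R →
    ∃ k ∈ K, R.map (MulAut.conj k).toMonoidHom = rightTranslations G

/-- A (finite) group `G` is an `NCI^(2)`-group if every 2-closed permutation group `K` on `G`
with `G_r ≤ K ≤ Hol(G)` is `G`-transjugate. -/
def IsNCI2Group (G : Type*) [Group G] : Prop :=
  ∀ K : Subgroup (Equiv.Perm G), rightTranslations G ≤ K → IsTwoClosed K → K ≤ holomorph G →
    IsGTransjugate K

end PermGroup

/-! Identify `G` with `ZMod n`. Every element of the holomorph is then an affine map `x ↦ a * x +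
b`, and `G_r` consists of those with `a = 1`.

If `8 ∤ n`, every regular cyclic `R ≤ K` of order `n` equals `G_r`. Transitivity of a generator
forces `a ≡ 1` modulo each prime divisor of `n`, and modulo 4 if `4 ∣ n`. If `a ≠ 1`, some power of
`a` has prime order `p`. The case `p = 2` is excluded by arithmetic, since `8 ∤ n`. For `p` odd,
that power is `1 + (n / p) * s` with `p ∤ s` and `p² ∣ n`; then the 2-closure of `K` contains a
non-affine map (`not_isAffine_of_isTwoClosed`), which is impossible.

If `n = 8 * u`, the affine maps with `a = 1` or `a = 1 + 4 * u` form a 2-closed group normalizing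
`G_r`. In it `x ↦ (1 + 4 * u) * x + 1` generates a regular cyclic subgroup other than `G_r`, hence
not conjugate to it. -/

open PermGroup

/-! ### Divisibility constraints on `1 + t` of prime order modulo `n` -/

theorem Int.dvd_prime_mul_of_dvd_one_add_pow_sub_one {n t : ℤ} {p : ℕ} (hp : p.Prime)
    (hp2 : p ≠ 2) (hq : ∀ q : ℕ, q.Prime → (q : ℤ) ∣ n → (q : ℤ) ∣ t)
    (h : n ∣ (1 + t) ^ p - 1) : n ∣ p * t := by
  have coprime_of {w : ℤ} (hw : ∀ q : ℕ, q.Prime → (q : ℤ) ∣ n → ¬ (q : ℤ) ∣ w) :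
      IsCoprime n w := by
    rw [Int.isCoprime_iff_gcd_eq_one]
    by_contra hne
    obtain ⟨q, hqp, hqd⟩ := Nat.exists_prime_and_dvd hne
    have := Int.natCast_dvd_natCast.2 hqd
    exact hw q hqp (this.trans (Int.gcd_dvd_left ..)) (this.trans (Int.gcd_dvd_right ..))
  by_cases hpn : (p : ℤ) ∣ n
  · obtain ⟨v, hv⟩ := hq p hp hpn
    have hp3 : 3 ≤ p := by have := hp.two_le; omega
    -- In the binomial expansion the middle terms are divisible by `p * t ^ 2` through `p.choose i`.
    -- The last term `t ^ p` is too, because `p ∣ t` and `p ≥ 3`. The factor `1 + t * w` is coprime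
    -- to `n`.
    have key : ∃ w, (1 + t) ^ p - 1 = p * t * (1 + t * w) := by
      have h1 : (1 + t) ^ p = ∑ i ∈ Finset.range (p + 1), t ^ i * (p.choose i : ℤ) := by
        rw [add_comm, add_pow]; simp
      obtain ⟨m, rfl⟩ : ∃ m, p = m + 3 := ⟨p - 3, by omega⟩
      rw [Finset.sum_range_succ, Finset.sum_range_succ', Finset.sum_range_succ'] at h1
      have h2 : ((m + 3 : ℕ) : ℤ) * t * t ∣
          ∑ i ∈ Finset.range (m + 1), t ^ (i + 1 + 1) * ((m + 3).choose (i + 1 + 1) : ℤ) := by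
        refine Finset.dvd_sum fun i hi => ?_
        have hi' := Finset.mem_range.1 hi
        obtain ⟨c, hc⟩ := hp.dvd_choose_self (k := i + 1 + 1) (by omega) (by omega)
        refine ⟨t ^ i * c, ?_⟩
        rw [hc]; push_cast; ring
      obtain ⟨c, hc⟩ := h2
      rw [hc] at h1
      refine ⟨c + v * t ^ m, ?_⟩
      have h3 : t ^ (m + 3) = ((m + 3 : ℕ) : ℤ) * t * t * (v * t ^ m) := by
        calc t ^ (m + 3) = t * t * t ^ m * t := by ring
          _ = t * t * t ^ m * (((m + 3 : ℕ) : ℤ) * v) := by rw [← hv]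
          _ = _ := by ring
      rw [h1, h3]; simp; ring
    obtain ⟨w, hw⟩ := key
    rw [hw] at h
    refine (coprime_of fun q hqp hqn hqw => ?_).dvd_of_dvd_mul_right h
    have := (Int.dvd_add_left (Dvd.dvd.mul_right (hq q hqp hqn) w)).1 hqw
    exact hqp.one_lt.ne' (by exact_mod_cast Int.eq_one_of_dvd_one (by positivity) this)
  · refine Dvd.dvd.mul_left ?_ _
    have h1 : (1 + t) ^ p - 1 = t * ∑ i ∈ Finset.range p, (1 + t) ^ i := by
      rw [← mul_geom_sum]; ring
    rw [h1] at h
    refine (coprime_of fun q hqp hqn hqw => ?_).dvd_of_dvd_mul_right h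
    -- The geometric sum is `p` modulo `t`, so a prime common to it and `n` would be `p` itself.
    have h2 : t ∣ (∑ i ∈ Finset.range p, (1 + t) ^ i) - p := by
      have : (∑ i ∈ Finset.range p, (1 + t) ^ i) - p =
          ∑ i ∈ Finset.range p, ((1 + t) ^ i - 1) := by simp
      rw [this]
      exact Finset.dvd_sum fun i _ => by simpa using sub_dvd_pow_sub_pow (1 + t) 1 i
    have h3 : (q : ℤ) ∣ p := by
      have := dvd_sub hqw ((hq q hqp hqn).trans h2)
      simpa using this
    rw [Int.natCast_dvd_natCast, Nat.prime_dvd_prime_iff_eq hqp hp] at h3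
    exact hpn (h3 ▸ hqn)

/-- Here `n ∣ t * (t + 2)`. An odd prime divisor of `n` divides `t`, hence not `t + 2`, which
settles the odd part of `n`. The 2-part is at most 4 and is covered by the hypotheses. -/
theorem Int.dvd_of_dvd_one_add_sq_sub_one {n t : ℤ} (h8 : ¬ 8 ∣ n)
    (hq : ∀ q : ℕ, q.Prime → (q : ℤ) ∣ n → (q : ℤ) ∣ t) (h4 : 4 ∣ n → 4 ∣ t)
    (h : n ∣ (1 + t) ^ 2 - 1) : n ∣ t := by
  have odd_case : ∀ m : ℤ, m ∣ n → ¬ 2 ∣ m → m ∣ t := by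
    intro m hmn hm
    have h1 : m ∣ t * (t + 2) := by
      refine (hmn.trans h).trans (dvd_of_eq (by ring))
    refine IsCoprime.dvd_of_dvd_mul_right ?_ h1
    rw [Int.isCoprime_iff_gcd_eq_one]
    by_contra hne
    obtain ⟨q, hqp, hqd⟩ := Nat.exists_prime_and_dvd hne
    have hqd' := Int.natCast_dvd_natCast.2 hqd
    have hqm := hqd'.trans (Int.gcd_dvd_left ..)
    have hqt := hqd'.trans (Int.gcd_dvd_right ..)
    have h3 : (q : ℤ) ∣ (2 : ℕ) := by
      simpa using dvd_sub hqt (hq q hqp (hqm.trans hmn))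
    rw [Int.natCast_dvd_natCast, Nat.prime_dvd_prime_iff_eq hqp Nat.prime_two] at h3
    subst h3
    exact hm (by exact_mod_cast hqm)
  by_cases h2 : 2 ∣ n
  · have ht2 : 2 ∣ t := by exact_mod_cast hq 2 Nat.prime_two (by exact_mod_cast h2)
    by_cases h4n : 4 ∣ n
    · obtain ⟨m, rfl⟩ := h4n
      have hm : ¬ 2 ∣ m := by omega
      refine IsCoprime.mul_dvd ?_ (h4 (by simp)) (odd_case m (by simp) hm)
      rw [show (4 : ℤ) = 2 ^ 2 by norm_num]
      exact ((Int.prime_two.coprime_iff_not_dvd).2 hm).pow_left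
    · obtain ⟨m, rfl⟩ := h2
      have hm : ¬ 2 ∣ m := by omega
      exact IsCoprime.mul_dvd ((Int.prime_two.coprime_iff_not_dvd).2 hm) ht2
        (odd_case m (by simp) hm)
  · exact odd_case n dvd_rfl h2

/-! ### Affine coordinates on the holomorph -/

namespace PermGroup

variable {G : Type*} {n : ℕ}

/-- In the additive coordinate `e`, the map `f` is `x ↦ a * x + b`. -/
def IsAffine (e : G ≃ ZMod n) (f : Equiv.Perm G) (a b : ZMod n) : Prop :=
  ∀ x, e (f x) = a * e x + b

theorem IsAffine.mul {e : G ≃ ZMod n} {f g : Equiv.Perm G} {a b c d : ZMod n}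
    (hf : IsAffine e f a b) (hg : IsAffine e g c d) : IsAffine e (f * g) (a * c) (a * d + b) := by
  intro x
  rw [Equiv.Perm.mul_apply, hf, hg]; ring

theorem IsAffine.pow {e : G ≃ ZMod n} {f : Equiv.Perm G} {a b : ZMod n}
    (hf : IsAffine e f a b) (k : ℕ) : ∃ c, IsAffine e (f ^ k) (a ^ k) c := by
  induction k with
  | zero => exact ⟨0, fun x => by simp⟩
  | succ k ih =>
    obtain ⟨c, hc⟩ := ih
    exact ⟨_, by simpa only [pow_succ] using hc.mul hf⟩

variable [Group G]

theorem isAffine_mulRight {e : G ≃ ZMod n} (he : ∀ x y, e (x * y) = e x + e y) (g : G) :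
    IsAffine e (Equiv.mulRight g) 1 (e g) := fun x => by simp [he]

theorem mem_rightTranslations_iff {e : G ≃ ZMod n} (he : ∀ x y, e (x * y) = e x + e y)
    {f : Equiv.Perm G} : f ∈ rightTranslations G ↔ ∃ b, IsAffine e f 1 b := by
  rw [mem_rightTranslations]
  constructor
  · rintro ⟨g, rfl⟩
    exact ⟨_, isAffine_mulRight he g⟩
  · rintro ⟨b, hb⟩
    refine ⟨e.symm b, Equiv.ext fun x => e.injective ?_⟩
    rw [hb, isAffine_mulRight he]; simp

/-- Conjugation by `f` sends translation by the generator to some translation by `g`, so each unit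
step of the argument changes the value by the constant `e g`. -/
theorem exists_isAffine_of_mem_holomorph [NeZero n] {e : G ≃ ZMod n}
    (he : ∀ x y, e (x * y) = e x + e y) {f : Equiv.Perm G} (hf : f ∈ holomorph G) :
    ∃ a b, IsAffine e f a b := by
  have h := (Subgroup.mem_normalizer_iff.1 hf (Equiv.mulRight (e.symm 1))).1
    (mem_rightTranslations.2 ⟨_, rfl⟩)
  obtain ⟨g, hg⟩ := mem_rightTranslations.1 h
  have h1 : ∀ x, f (x * e.symm 1) = f x * g := fun x => by
    have := Equiv.congr_fun hg (f x)
    simpa using this.symm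
  have h2 : ∀ k : ℕ, e (f (e.symm (k : ZMod n))) = e g * k + e (f (e.symm 0)) := by
    intro k
    induction k with
    | zero => simp
    | succ k ih =>
      have : e.symm ((k + 1 : ℕ) : ZMod n) = e.symm (k : ZMod n) * e.symm 1 :=
        e.injective (by simp [he])
      rw [this, h1, he, ih]; push_cast; ring
  refine ⟨e g, e (f (e.symm 0)), fun x => ?_⟩
  have := h2 (e x).val
  simpa using this

theorem exists_equiv_zmod (G : Type*) [Group G] [Finite G] [IsCyclic G] :
    ∃ e : G ≃ ZMod (Nat.card G), ∀ x y, e (x * y) = e x + e y :=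
  ⟨(zmodCyclicMulEquiv ‹IsCyclic G›).symm.toEquiv.trans Multiplicative.toAdd,
    fun x y => by simp⟩

end PermGroup

/-! ### Linear parts in a 2-closed group -/

namespace PermGroup

variable {Ω G : Type*} [Group G] {n : ℕ}

theorem exists_mem_isAffine_of_mem {e : G ≃ ZMod n} (he : ∀ x y, e (x * y) = e x + e y)
    {K : Subgroup (Equiv.Perm G)} (hK : rightTranslations G ≤ K) {f : Equiv.Perm G} (hf : f ∈ K)
    {a b : ZMod n} (h : IsAffine e f a b) (c : ZMod n) : ∃ k ∈ K, IsAffine e k a c := by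
  refine ⟨Equiv.mulRight (e.symm (c - b)) * f,
    K.mul_mem (hK (mem_rightTranslations.2 ⟨_, rfl⟩)) hf, fun x => ?_⟩
  rw [(isAffine_mulRight he _).mul h]; simp

/-- A 2-closed subgroup of the holomorph of a cyclic group contains no affine map whose linear
part is `1 + m * s`, where `n = p * m`, `p` is an odd prime dividing `m` and `p ∤ s`. -/
theorem not_isAffine_of_isTwoClosed [NeZero n] {e : G ≃ ZMod n}
    (he : ∀ x y, e (x * y) = e x + e y) {K : Subgroup (Equiv.Perm G)}
    (hK : rightTranslations G ≤ K) (hcl : IsTwoClosed K) (hhol : K ≤ holomorph G)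
    {p m : ℕ} (hp : p.Prime) (hp2 : p ≠ 2) (hn : n = p * m) (hpm : p ∣ m) {s : ℤ}
    (hs : ¬ (p : ℤ) ∣ s) {f : Equiv.Perm G} (hf : f ∈ K) {b : ZMod n} :
    ¬ IsAffine e f (1 + m * s) b := by
  intro hfa
  have := Fact.mk hp
  have hpn : p ∣ n := ⟨m, hn⟩
  have hpm0 : (p : ZMod n) * m = 0 := by rw [← Nat.cast_mul, ← hn]; simp
  have hmm : (m : ZMod n) * m = 0 := by
    obtain ⟨c, hc⟩ := hpm
    calc (m : ZMod n) * m = p * m * c := by nth_rewrite 1 [hc]; push_cast; ring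
      _ = 0 := by rw [hpm0, zero_mul]
  let π := ZMod.castHom hpn (ZMod p)
  have hπm : π m = 0 := by
    rw [map_natCast]; exact (ZMod.natCast_eq_zero_iff _ _).2 hpm
  let φ : ZMod n → ℤ := fun x => if π x = 0 then 1 else 0
  have hφ : ∀ x y, π x = π y → φ x = φ y := fun x y h => by simp only [φ, h]
  -- `F` shifts by `m` exactly the points that are 0 modulo `p`; as `p ∣ m`, it preserves residues
  -- modulo `p`.
  let F : Equiv.Perm (ZMod n) :=
    { toFun := fun x => x + m * φ x
      invFun := fun x => x - m * φ x
      left_inv := fun x => by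
        have : φ (x + m * φ x) = φ x := hφ _ _ (by simp [hπm])
        simp only [this]; ring
      right_inv := fun x => by
        have : φ (x - m * φ x) = φ x := hφ _ _ (by simp [hπm])
        simp only [this]; ring }
  have hF : ∀ x, F x = x + m * φ x := fun x => rfl
  let g : Equiv.Perm G := (e.trans F).trans e.symm
  have hg : ∀ x, e (g x) = e x + m * φ (e x) := fun x => by simp [g, hF]
  have hpow : ∀ i : ℕ, (1 + m * s : ZMod n) ^ i = 1 + i * (m * s) := by
    intro i
    induction i with
    | zero => simp
    | succ i ih =>
      rw [pow_succ, ih]; push_cast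
      linear_combination (i * s * s : ZMod n) * hmm
  have hgK : g ∈ twoClosure K := by
    refine mem_twoClosure.2 fun x y => ?_
    -- Translations lie in `K`, so matching `g` on a pair only requires a power of the linear part
    -- with the right effect on the difference.
    suffices H : ∃ i : ℕ,
        (1 + m * s : ZMod n) ^ i * (e y - e x) = e y - e x + m * (φ (e y) - φ (e x)) by
      obtain ⟨i, hi⟩ := H
      obtain ⟨c, hc⟩ := hfa.pow i
      obtain ⟨k, hk, hka⟩ := exists_mem_isAffine_of_mem he hK (K.pow_mem hf i) hc
        (e (g x) - (1 + m * s : ZMod n) ^ i * e x)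
      refine ⟨k, hk, e.injective ?_, e.injective ?_⟩
      · rw [hka]; ring
      · rw [hka, hg, hg]; linear_combination hi
    by_cases hxy : π (e x) = π (e y)
    · exact ⟨0, by rw [hφ _ _ hxy]; ring⟩
    · obtain ⟨d, hd⟩ := ZMod.intCast_surjective (e y - e x)
      have hd0 : (d : ZMod p) ≠ 0 := by
        intro h0
        have h1 : π (e y - e x) = 0 := by rw [← hd, map_intCast, h0]
        rw [map_sub, sub_eq_zero] at h1
        exact hxy h1.symm
      have hs0 : (s : ZMod p) ≠ 0 := fun h0 => hs ((ZMod.intCast_zmod_eq_zero_iff_dvd s p).1 h0)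
      set δ : ℤ := φ (e y) - φ (e x) with hδ
      -- Since `m * m = 0`, the power `i` adds `i * m * s * d` to `d`. As `p * m = 0`, it is enough
      -- to solve `i * s * d = δ` modulo `p`.
      obtain ⟨i, hi⟩ := ZMod.natCast_zmod_surjective ((δ : ZMod p) / ((s : ZMod p) * (d : ZMod p)))
      have h1 : ((i * (s * d) - δ : ℤ) : ZMod p) = 0 := by
        push_cast; rw [hi]; field_simp; simp
      obtain ⟨c, hc⟩ := (ZMod.intCast_zmod_eq_zero_iff_dvd _ p).1 h1
      have hc' := congrArg (Int.cast : ℤ → ZMod n) hc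
      have hδ' := congrArg (Int.cast : ℤ → ZMod n) hδ
      push_cast at hc' hδ'
      refine ⟨i, ?_⟩
      rw [hpow, ← hδ', ← hd]
      linear_combination (m : ZMod n) * hc' + (c : ZMod n) * hpm0
  rw [hcl] at hgK
  obtain ⟨α, β, hαβ⟩ := exists_isAffine_of_mem_holomorph he (hhol hgK)
  have hv : ∀ z : ZMod n, z + m * φ z = α * z + β := fun z => by
    have := (hg (e.symm z)).symm.trans (hαβ (e.symm z))
    simpa using this
  -- An affine map has zero second difference at 0, 1, 2, whereas that of `F` is `m`. Oddness of `p`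
  -- ensures that 2 is not shifted.
  have hφ0 : φ 0 = 1 := by simp [φ]
  have hφ1 : φ 1 = 0 := by simp [φ]
  have hφ2 : φ 2 = 0 := by
    have : (2 : ZMod p) ≠ 0 := by
      intro h
      have h' : ((2 : ℕ) : ZMod p) = 0 := by exact_mod_cast h
      rw [ZMod.natCast_eq_zero_iff, Nat.prime_dvd_prime_iff_eq hp Nat.prime_two] at h'
      exact hp2 h'
    simpa only [φ, map_ofNat, ite_eq_right_iff, one_ne_zero, imp_false] using this
  have e0 := hv 0
  have e1 := hv 1
  have e2 := hv 2
  rw [hφ0] at e0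
  rw [hφ1] at e1
  rw [hφ2] at e2
  push_cast at e0 e1 e2
  have hm0 : (m : ZMod n) = 0 := by linear_combination e0 - 2 * e1 + e2
  rw [ZMod.natCast_eq_zero_iff] at hm0
  have hmpos : 0 < m := Nat.pos_of_ne_zero fun h => NeZero.ne n (by simp [hn, h])
  have := Nat.le_of_dvd hmpos hm0
  have := hp.two_le
  nlinarith

theorem linear_part_eq_one [NeZero n] {e : G ≃ ZMod n} (he : ∀ x y, e (x * y) = e x + e y)
    {K : Subgroup (Equiv.Perm G)} (hK : rightTranslations G ≤ K) (hcl : IsTwoClosed K)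
    (hhol : K ≤ holomorph G) (h8 : ¬ 8 ∣ n) {t : ℤ}
    (hq : ∀ q : ℕ, q.Prime → q ∣ n → (q : ℤ) ∣ t) (h4 : 4 ∣ n → 4 ∣ t)
    {f : Equiv.Perm G} (hf : f ∈ K) {b : ZMod n} (hfa : IsAffine e f (1 + t) b) :
    (1 + t : ZMod n) = 1 := by
  have : Finite G := Finite.of_equiv _ e.symm
  -- Every prime divides the default `orderOf` value 0, so finite order is needed to make `m`
  -- positive below.
  have hfin : IsOfFinOrder (1 + t : ZMod n) := by
    obtain ⟨N, hN, hfN⟩ := isOfFinOrder_iff_pow_eq_one.1 (isOfFinOrder_of_finite f)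
    refine isOfFinOrder_iff_pow_eq_one.2 ⟨N, hN, ?_⟩
    obtain ⟨c, hc⟩ := hfa.pow N
    rw [hfN] at hc
    have h0 := hc (e.symm 0)
    have h1 := hc (e.symm 1)
    simp only [Equiv.Perm.one_apply, Equiv.apply_symm_apply, mul_zero, zero_add, mul_one] at h0 h1
    rw [← h0] at h1
    simpa using h1.symm
  by_contra hne
  obtain ⟨p, hp, m, hm⟩ := Nat.exists_prime_and_dvd (mt orderOf_eq_one_iff.1 hne)
  set t' : ℤ := (1 + t) ^ m - 1 with ht'
  have hcast : (1 + t' : ZMod n) = (1 + t) ^ m := by rw [ht']; push_cast; ring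
  have htt : t ∣ t' := by simpa using sub_dvd_pow_sub_pow (1 + t) 1 m
  have hnt : ¬ (n : ℤ) ∣ t' := by
    intro h
    rw [(ZMod.intCast_zmod_eq_zero_iff_dvd t' n).2 h, add_zero] at hcast
    have h1 := orderOf_dvd_of_pow_eq_one hcast.symm
    have h2 : 0 < m := Nat.pos_of_ne_zero fun h => hfin.orderOf_pos.ne' (by simp [hm, h])
    have := Nat.le_of_dvd h2 h1
    have := hp.two_le
    nlinarith
  have hpow : (n : ℤ) ∣ (1 + t') ^ p - 1 := by
    refine (ZMod.intCast_zmod_eq_zero_iff_dvd _ n).1 ?_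
    push_cast
    rw [hcast, ← pow_mul, mul_comm m p, ← hm, pow_orderOf_eq_one, sub_self]
  have hq' : ∀ q : ℕ, q.Prime → (q : ℤ) ∣ n → (q : ℤ) ∣ t' := fun q hqp hqn =>
    (hq q hqp (Int.natCast_dvd_natCast.1 hqn)).trans htt
  obtain rfl | hp2 := eq_or_ne p 2
  · exact hnt (Int.dvd_of_dvd_one_add_sq_sub_one (by exact_mod_cast h8) hq'
      (fun h => (h4 (by exact_mod_cast h)).trans htt) hpow)
  · obtain ⟨s, hs⟩ := Int.dvd_prime_mul_of_dvd_one_add_pow_sub_one hp hp2 hq' hpow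
    have hp0 : (p : ℤ) ≠ 0 := by exact_mod_cast hp.ne_zero
    have hps : ¬ (p : ℤ) ∣ s := by
      rintro ⟨c, rfl⟩
      exact hnt ⟨c, mul_left_cancel₀ hp0 (by rw [hs]; ring)⟩
    have hpp : Prime (p : ℤ) := Nat.prime_iff_prime_int.1 hp
    have hpn : p ∣ n := Int.natCast_dvd_natCast.1
      ((hpp.dvd_or_dvd (Dvd.intro _ hs)).resolve_right hps)
    obtain ⟨l, hl⟩ := hpn
    have htl : t' = l * s := mul_left_cancel₀ hp0 (by rw [hs, hl]; push_cast; ring)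
    have hpl : p ∣ l := by
      have := hq' p hp (by rw [hl]; simp)
      rw [htl] at this
      exact Int.natCast_dvd_natCast.1 ((hpp.dvd_or_dvd this).resolve_right hps)
    obtain ⟨c, hc⟩ := hfa.pow m
    rw [← hcast, htl] at hc
    push_cast at hc
    exact not_isAffine_of_isTwoClosed he hK hcl hhol hp hp2 hl hpl hps (K.pow_mem hf m) hc

/-! ### Transitive affine maps and regular subgroups -/

theorem eq_univ_of_transitive_affine {e : Ω ≃ ZMod n} {r : Equiv.Perm Ω} {a b : ZMod n}
    (hr : IsAffine e r a b) (htr : ∀ x y, ∃ k : ℕ, (r ^ k) x = y) {d : ℕ} (hd : d ∣ n)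
    {S : Set (ZMod d)} (hS : S.Nonempty)
    (hinv : ∀ z ∈ S, ZMod.castHom hd (ZMod d) a * z + ZMod.castHom hd (ZMod d) b ∈ S)
    (z : ZMod d) : z ∈ S := by
  obtain ⟨w, hw⟩ := hS
  obtain ⟨x, rfl⟩ := ZMod.castHom_surjective hd w
  obtain ⟨y, rfl⟩ := ZMod.castHom_surjective hd z
  obtain ⟨k, hk⟩ := htr (e.symm x) (e.symm y)
  have key : ∀ k : ℕ, ZMod.castHom hd (ZMod d) (e ((r ^ k) (e.symm x))) ∈ S := by
    intro k
    induction k with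
    | zero => simpa using hw
    | succ k ih =>
      rw [pow_succ', Equiv.Perm.mul_apply, hr, map_add, map_mul]
      exact hinv _ ih
  simpa [hk] using key k

/-- Otherwise the reduction modulo `q` would fix the point `b / (1 - a)`, a proper invariant set. -/
theorem castHom_eq_one_of_transitive {e : Ω ≃ ZMod n} {r : Equiv.Perm Ω} {a b : ZMod n}
    (hr : IsAffine e r a b) (htr : ∀ x y, ∃ k : ℕ, (r ^ k) x = y) {q : ℕ} (hq : q.Prime)
    (hd : q ∣ n) : ZMod.castHom hd (ZMod q) a = 1 := by
  have := Fact.mk hq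
  by_contra hne
  have h0 : 1 - ZMod.castHom hd (ZMod q) a ≠ 0 := sub_ne_zero.2 (Ne.symm hne)
  set x := ZMod.castHom hd (ZMod q) b / (1 - ZMod.castHom hd (ZMod q) a) with hx
  have := eq_univ_of_transitive_affine hr htr hd (Set.singleton_nonempty x) (by
    rintro z rfl
    rw [Set.mem_singleton_iff, hx]; field_simp; ring) (x + 1)
  simp at this

theorem castHom_four_eq_one_of_transitive {e : Ω ≃ ZMod n} {r : Equiv.Perm Ω} {a b : ZMod n}
    (hr : IsAffine e r a b) (htr : ∀ x y, ∃ k : ℕ, (r ^ k) x = y) (hd : 4 ∣ n) :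
    ZMod.castHom hd (ZMod 4) a = 1 := by
  by_contra hne
  -- Fixed points do not suffice modulo 4, as `x ↦ 3 * x + 1` has none; an invariant set `{u, v}`
  -- missing `w` always exists.
  have h : ∀ α β : ZMod 4, α ≠ 1 → ∃ u v w, w ≠ u ∧ w ≠ v ∧
      (α * u + β = u ∨ α * u + β = v) ∧ (α * v + β = u ∨ α * v + β = v) := by decide
  obtain ⟨u, v, w, h1, h2, h3, h4⟩ := h _ (ZMod.castHom hd (ZMod 4) b) hne
  have := eq_univ_of_transitive_affine hr htr hd (Set.insert_nonempty u {v}) (by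
    rintro z (rfl | rfl) <;> assumption) w
  exact this.elim h1 h2

theorem card_eq_of_isRegularPerm [Finite G] {R : Subgroup (Equiv.Perm G)} (hR : IsRegularPerm R) :
    Nat.card R = Nat.card G := by
  obtain ⟨htr, hst⟩ := hR
  refine Nat.card_congr (Equiv.ofBijective (fun ρ : R => ρ • (1 : G)) ⟨fun ρ σ h => ?_, fun x => ?_⟩)
  · have : σ⁻¹ * ρ ∈ MulAction.stabilizer R (1 : G) := by
      rw [MulAction.mem_stabilizer_iff, mul_smul]
      exact (congrArg (σ⁻¹ • ·) h).trans (inv_smul_smul σ 1)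
    rw [hst, Subgroup.mem_bot, inv_mul_eq_one] at this
    exact this.symm
  · exact MulAction.exists_smul_eq R 1 x

theorem card_rightTranslations [Finite G] : Nat.card (rightTranslations G) = Nat.card G := by
  refine (Nat.card_congr (Equiv.ofBijective (fun g : G =>
    (⟨Equiv.mulRight g, mem_rightTranslations.2 ⟨g, rfl⟩⟩ : rightTranslations G))
    ⟨fun g h hgh => ?_, fun f => ?_⟩)).symm
  · have := Equiv.congr_fun (congrArg Subtype.val hgh) 1
    simpa using this
  · obtain ⟨g, hg⟩ := mem_rightTranslations.1 f.2
    exact ⟨g, Subtype.ext hg⟩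

theorem isNCI2Group_of_not_eight_dvd [Finite G] [IsCyclic G] (h8 : ¬ 8 ∣ Nat.card G) :
    IsNCI2Group G := by
  intro K hK hcl hhol R hRK hR
  obtain ⟨e, he⟩ := exists_equiv_zmod G
  have : NeZero (Nat.card G) := ⟨Nat.card_pos.ne'⟩
  obtain ⟨hreg, ⟨ψ⟩⟩ := hR
  have : IsCyclic R := isCyclic_of_surjective ψ.symm ψ.symm.surjective
  obtain ⟨⟨r, hrR⟩, hgen⟩ := IsCyclic.exists_generator (α := R)
  have htr : ∀ x y, ∃ k : ℕ, (r ^ k) x = y := by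
    intro x y
    have := hreg.1
    obtain ⟨ρ, hρ⟩ := MulAction.exists_smul_eq R x y
    obtain ⟨k, hk⟩ := mem_powers_iff_mem_zpowers.2 (hgen ρ)
    refine ⟨k, ?_⟩
    rw [← hρ, ← hk]; rfl
  obtain ⟨a, b, hab⟩ := exists_isAffine_of_mem_holomorph he (hhol (hRK hrR))
  obtain ⟨t, ht⟩ := ZMod.intCast_surjective (a - 1)
  obtain rfl : a = 1 + t := by rw [ht]; ring
  have ha : (1 + t : ZMod (Nat.card G)) = 1 := by
    refine linear_part_eq_one he hK hcl hhol h8 (fun q hq hd => ?_) (fun hd => ?_) (hRK hrR) hab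
    · have := castHom_eq_one_of_transitive hab htr hq hd
      rw [map_add, map_one, map_intCast, add_eq_left] at this
      exact (ZMod.intCast_zmod_eq_zero_iff_dvd _ _).1 this
    · have := castHom_four_eq_one_of_transitive hab htr hd
      rw [map_add, map_one, map_intCast, add_eq_left] at this
      exact_mod_cast (ZMod.intCast_zmod_eq_zero_iff_dvd _ _).1 this
  rw [ha] at hab
  have hle : R ≤ rightTranslations G := by
    intro ρ hρ
    obtain ⟨k, hk⟩ := hgen ⟨ρ, hρ⟩
    obtain rfl : r ^ k = ρ := congrArg Subtype.val hk
    exact Subgroup.zpow_mem _ ((mem_rightTranslations_iff he).2 ⟨b, hab⟩) k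
  obtain rfl : R = rightTranslations G := Subgroup.eq_of_le_of_card_ge hle
    (by rw [card_eq_of_isRegularPerm hreg, card_rightTranslations])
  refine ⟨1, K.one_mem, ?_⟩
  rw [map_one]
  exact Subgroup.map_id _

/-! ### The counterexample when `8 ∣ n` -/

/-- The group of the maps `x ↦ a * x + b` with `a = 1` or `a = 1 + h`. -/
def affineSubgroup (e : Ω ≃ ZMod n) (h : ZMod n) (h2 : 2 * h = 0) (hh : h * h = 0) :
    Subgroup (Equiv.Perm Ω) where
  carrier := {f | ∃ a b, (a = 1 ∨ a = 1 + h) ∧ IsAffine e f a b}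
  one_mem' := ⟨1, 0, Or.inl rfl, fun x => by simp⟩
  mul_mem' := by
    rintro f g ⟨a, b, ha, hf⟩ ⟨c, d, hc, hg⟩
    refine ⟨_, _, ?_, hf.mul hg⟩
    rcases ha with rfl | rfl <;> rcases hc with rfl | rfl
    · exact Or.inl (by ring)
    · exact Or.inr (by ring)
    · exact Or.inr (by ring)
    · exact Or.inl (by linear_combination h2 + hh)
  inv_mem' := by
    rintro f ⟨a, b, ha, hf⟩
    have haa : a * a = 1 := by
      rcases ha with rfl | rfl
      · ring
      · linear_combination h2 + hh
    refine ⟨a, -(a * b), ha, fun x => ?_⟩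
    have := hf (f⁻¹ x)
    rw [← Equiv.Perm.mul_apply, mul_inv_cancel, Equiv.Perm.one_apply] at this
    rw [this]
    linear_combination (-e (f⁻¹ x)) * haa

theorem mem_affineSubgroup {e : Ω ≃ ZMod n} {h : ZMod n} {h2 : 2 * h = 0} {hh : h * h = 0}
    {f : Equiv.Perm Ω} :
    f ∈ affineSubgroup e h h2 hh ↔ ∃ a b, (a = 1 ∨ a = 1 + h) ∧ IsAffine e f a b := Iff.rfl

theorem rightTranslations_le_affineSubgroup {e : G ≃ ZMod n}
    (he : ∀ x y, e (x * y) = e x + e y) {h : ZMod n} (h2 : 2 * h = 0) (hh : h * h = 0) :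
    rightTranslations G ≤ affineSubgroup e h h2 hh := fun _ hf =>
  let ⟨b, hb⟩ := (mem_rightTranslations_iff he).1 hf
  ⟨1, b, Or.inl rfl, hb⟩

theorem conj_mem_rightTranslations {e : G ≃ ZMod n} (he : ∀ x y, e (x * y) = e x + e y)
    {f g : Equiv.Perm G} {a b : ZMod n} (hf : IsAffine e f a b) (hg : g ∈ rightTranslations G) :
    f * g * f⁻¹ ∈ rightTranslations G := by
  obtain ⟨c, hc⟩ := (mem_rightTranslations_iff he).1 hg
  refine (mem_rightTranslations_iff he).2 ⟨a * c, fun x => ?_⟩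
  obtain ⟨y, rfl⟩ := f.surjective x
  have : (f * g * f⁻¹) (f y) = f (g y) := by simp
  rw [this, hf, hc, hf]; ring

theorem affineSubgroup_le_holomorph {e : G ≃ ZMod n} (he : ∀ x y, e (x * y) = e x + e y)
    {h : ZMod n} (h2 : 2 * h = 0) (hh : h * h = 0) :
    affineSubgroup e h h2 hh ≤ holomorph G := by
  intro f hf
  obtain ⟨a, b, -, hfa⟩ := mem_affineSubgroup.1 hf
  obtain ⟨c, d, -, hfi⟩ := mem_affineSubgroup.1 (inv_mem hf)
  refine Subgroup.mem_normalizer_iff.2 fun g =>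
    ⟨conj_mem_rightTranslations he hfa, fun hg => ?_⟩
  have := conj_mem_rightTranslations he hfi hg
  simpa [mul_assoc] using this

theorem exists_eq_two_mul_or (z : ZMod n) : ∃ w, z = 2 * w ∨ z = 2 * w + 1 := by
  obtain ⟨k, rfl⟩ := ZMod.intCast_surjective z
  obtain ⟨l, hl | hl⟩ := Int.even_or_odd' k
  · exact ⟨l, Or.inl (by rw [hl]; push_cast; ring)⟩
  · exact ⟨l, Or.inr (by rw [hl]; push_cast; ring)⟩

/-- Multiplication by `1 + h` fixes even elements because `2 * h = 0`. A map in the 2-closure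
therefore preserves even differences, so its values at 0 and 1 determine it. -/
theorem isTwoClosed_affineSubgroup (e : Ω ≃ ZMod n) {h : ZMod n} (h2 : 2 * h = 0)
    (hh : h * h = 0) : IsTwoClosed (affineSubgroup e h h2 hh) := by
  refine le_antisymm (fun f hf => ?_) ((isGreatest_twoClosure _).2 rfl)
  have hd : ∀ x y, e (f y) - e (f x) = e y - e x ∨ e (f y) - e (f x) = (1 + h) * (e y - e x) := by
    intro x y
    obtain ⟨k, ⟨a, b, ha, hk⟩, hx, hy⟩ := mem_twoClosure.1 hf x y
    rw [← hx, ← hy, hk, hk]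
    rcases ha with rfl | rfl
    · exact Or.inl (by ring)
    · exact Or.inr (by ring)
  have heven : ∀ x y w, e y - e x = 2 * w → e (f y) - e (f x) = e y - e x := by
    intro x y w hw
    rcases hd x y with h' | h'
    · exact h'
    · rw [h', hw]; linear_combination w * h2
  set a := e (f (e.symm 1)) - e (f (e.symm 0)) with ha
  have ha' : a = 1 ∨ a = 1 + h := by simpa [ha] using hd (e.symm 0) (e.symm 1)
  refine ⟨a, e (f (e.symm 0)), ha', fun x => ?_⟩
  obtain ⟨w, hw | hw⟩ := exists_eq_two_mul_or (e x)
  · have h1 := heven (e.symm 0) x w (by simpa using hw)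
    rw [Equiv.apply_symm_apply] at h1
    rcases ha' with h' | h' <;> rw [h']
    · linear_combination h1
    · rw [hw] at h1 ⊢
      linear_combination h1 - w * h2
  · have h1 := heven (e.symm 1) x w (by rw [hw]; simp)
    rw [Equiv.apply_symm_apply] at h1
    rcases ha' with h' | h' <;> rw [h'] <;> rw [h'] at ha
    · linear_combination h1 - ha
    · rw [hw] at h1 ⊢
      linear_combination h1 - ha - w * h2

theorem isRegularPerm_zpowers {r : Equiv.Perm Ω}
    (h : ∀ x y, ∃ k : ℤ, (r ^ k) x = y) : IsRegularPerm (Subgroup.zpowers r) := by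
  refine ⟨⟨fun x y => ?_⟩, fun x => (Subgroup.eq_bot_iff_forall _).2 ?_⟩
  · obtain ⟨k, hk⟩ := h x y
    exact ⟨⟨r ^ k, k, rfl⟩, hk⟩
  · rintro ⟨_, k, rfl⟩ hk
    refine Subtype.ext (Equiv.ext fun y => ?_)
    obtain ⟨l, rfl⟩ := h x y
    have hk' : (r ^ k) x = x := hk
    change (r ^ k) ((r ^ l) x) = (r ^ l) x
    rw [← Equiv.Perm.mul_apply, ← zpow_add, add_comm, zpow_add, Equiv.Perm.mul_apply, hk']

theorem isAffine_zpow {e : Ω ≃ ZMod n} {f : Equiv.Perm Ω} {b : ZMod n} (hf : IsAffine e f 1 b)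
    (k : ℤ) : IsAffine e (f ^ k) 1 (k * b) := by
  induction k with
  | zero => intro x; simp
  | succ k ih =>
    intro x
    rw [zpow_add_one, ih.mul hf]; push_cast; ring
  | pred k ih =>
    intro x
    have h1 := ih ((f⁻¹) x)
    have h2 := hf (f⁻¹ x)
    rw [← Equiv.Perm.mul_apply, mul_inv_cancel, Equiv.Perm.one_apply] at h2
    rw [zpow_sub_one, Equiv.Perm.mul_apply, h1, h2]; push_cast; ring

theorem transitive_zpow_of_isAffine {u : ℕ} {e : Ω ≃ ZMod (8 * u)} {r : Equiv.Perm Ω}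
    (hr : IsAffine e r (1 + 4 * u) 1) (x y : Ω) : ∃ k : ℤ, (r ^ k) x = y := by
  have h0 : (8 * u : ZMod (8 * u)) = 0 := by exact_mod_cast ZMod.natCast_self (8 * u)
  have hr2 : IsAffine e (r ^ 2) 1 (2 + 4 * u) := by
    intro z
    rw [sq, hr.mul hr]
    linear_combination (e z + 2 * u * e z) * h0
  have heven : ∀ x y w, e y - e x = 2 * w → ∃ k : ℤ, (r ^ k) x = y := by
    intro x y w hw
    obtain ⟨j, rfl⟩ := ZMod.intCast_surjective w
    -- `r ^ 2` is translation by `2 * (1 + 2 * u)`. Its power `1 - 2 * u` is translation by `2 - 8 *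
    -- u ^ 2 = 2`.
    refine ⟨2 * (j * (1 - 2 * u)), e.injective ?_⟩
    rw [zpow_mul, show r ^ (2 : ℤ) = r ^ 2 from rfl, isAffine_zpow hr2]
    push_cast
    linear_combination -hw - j * u * h0
  obtain ⟨w, hw | hw⟩ := exists_eq_two_mul_or (e y - e x)
  · exact heven x y w hw
  · obtain ⟨k, hk⟩ := heven (r x) y (w - 2 * u * e x) (by rw [hr]; linear_combination hw)
    exact ⟨k + 1, by rw [zpow_add_one, Equiv.Perm.mul_apply, hk]⟩

theorem not_isNCI2Group_of_eight_dvd [Finite G] [IsCyclic G] (h8 : 8 ∣ Nat.card G) :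
    ¬ IsNCI2Group G := by
  intro hG
  obtain ⟨u, hu⟩ := h8
  have hpos : 0 < u := Nat.pos_of_ne_zero fun h => Nat.card_pos.ne' (hu.trans (by simp [h]))
  obtain ⟨e, he⟩ : ∃ e : G ≃ ZMod (8 * u), ∀ x y, e (x * y) = e x + e y :=
    hu ▸ exists_equiv_zmod G
  have h0 : (8 * u : ZMod (8 * u)) = 0 := by exact_mod_cast ZMod.natCast_self (8 * u)
  have h2 : (2 * (4 * u) : ZMod (8 * u)) = 0 := by linear_combination h0
  have hh : (4 * u * (4 * u) : ZMod (8 * u)) = 0 := by linear_combination 2 * u * h0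
  have h4 : (4 * u : ZMod (8 * u)) ≠ 0 := by
    intro h
    have h' : ((4 * u : ℕ) : ZMod (8 * u)) = 0 := by exact_mod_cast h
    rw [ZMod.natCast_eq_zero_iff] at h'
    have := Nat.le_of_dvd (by omega) h'
    omega
  let F : Equiv.Perm (ZMod (8 * u)) :=
    { toFun := fun x => (1 + 4 * u) * x + 1
      invFun := fun x => (1 + 4 * u) * (x - 1)
      left_inv := fun x => by linear_combination (x + 2 * u * x) * h0
      right_inv := fun x => by linear_combination (x - 1) * (1 + 2 * u) * h0 }
  let r : Equiv.Perm G := (e.trans F).trans e.symm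
  have hr : IsAffine e r (1 + 4 * u) 1 := fun x => by simp [r, F]
  have hrK : r ∈ affineSubgroup e (4 * u) h2 hh := ⟨_, _, Or.inr rfl, hr⟩
  have hreg := isRegularPerm_zpowers (transitive_zpow_of_isAffine hr)
  obtain ⟨k, hk, hkr⟩ := hG _ (rightTranslations_le_affineSubgroup he h2 hh)
    (isTwoClosed_affineSubgroup e h2 hh) (affineSubgroup_le_holomorph he h2 hh)
    (Subgroup.zpowers r) (Subgroup.zpowers_le.2 hrK)
    ⟨hreg, ⟨mulEquivOfCyclicCardEq (card_eq_of_isRegularPerm hreg)⟩⟩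
  have hkrk : k * r * k⁻¹ ∈ rightTranslations G :=
    hkr ▸ Subgroup.mem_map_of_mem _ (Subgroup.mem_zpowers r)
  -- The conjugator normalizes `G_r`, so `r` itself would be a translation, forcing `4 * u = 0`.
  have hrt : r ∈ rightTranslations G :=
    (Subgroup.mem_normalizer_iff.1 (affineSubgroup_le_holomorph he h2 hh hk) r).2 hkrk
  obtain ⟨b, hb⟩ := (mem_rightTranslations_iff he).1 hrt
  have e0 := (hr (e.symm 0)).symm.trans (hb (e.symm 0))
  have e1 := (hr (e.symm 1)).symm.trans (hb (e.symm 1))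
  rw [Equiv.apply_symm_apply] at e0 e1
  exact h4 (by linear_combination e1 - e0)

end PermGroup

theorem corollary1p5 (G : Type*) [Group G] [Finite G] [IsCyclic G] :
    PermGroup.IsNCI2Group G ↔ ¬ 8 ∣ Nat.card G :=
  ⟨fun h h8 => PermGroup.not_isNCI2Group_of_eight_dvd h8 h,
    PermGroup.isNCI2Group_of_not_eight_dvd⟩
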